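/- Let $T$ be an arbitrary complete first-order theory and $\mathbb{M}$ a monster model of $T$: it suffices that $\mathbb{M}$ is $\mu$-saturated for some $\mu>\aleph_0$. "Small" means of cardinality $<\mu$. Below, $C\subseteq\mathbb{M}$ is a small set, tuples are small (possibly infinite) tuples of elements of $\mathbb{M}$, and $\kappa_1,\kappa_2$ are small cardinals (possibly finite). An inp-pattern of depth $\kappa$ in a partial type $p(x)$ over $C$ consists of an array $(a_{\alpha,i})_{\alpha<\kappa,\,i<\omega}$ of finite tuples in $\mathbb{M}$, formulas $\varphi_\alpha(x,y_\alpha)$ without parameters and numbers $k_\alpha<\omega$ such that (i) for each $\alpha<\kappa$ the family $(\varphi_\alpha(x,a_{\alpha,i}))_{i<\omega}$ is $k_\alpha$-inconsistent, i.e. any $k_\alpha$ of its members with distinct indices $i$ are jointly inconsistent; (ii) for every $f:\kappa\to\omega$ the set $p(x)\cup\{\varphi_\alpha(x,a_{\alpha,f(\alpha)}):\alpha<\kappa\}$ is consistent. The burden $\operatorname{bdn}(p)$ is the supremum of the depths of all inp-patterns in $p$, and $\operatorname{bdn}(a/C):=\operatorname{bdn}(\operatorname{tp}(a/C))$. (1)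 If there is an inp-pattern of depth $\kappa_1\times\kappa_2$ in $\operatorname{tp}(b_1b_2/C)$, then there is an inp-pattern of depth $\kappa_1$ in $\operatorname{tp}(b_1/C)$ or an inp-pattern of depth $\kappa_2$ in $\operatorname{tp}(b_2/b_1C)$. (2) (Sub-multiplicativity of burden.) If $n\in\omega$, $k_0,\dots,k_{n-1}\in\omega$ and $\operatorname{bdn}(a_i/C)<k_i$ for all $i<n$, then $\operatorname{bdn}(a_0\dots a_{n-1}/C)<\prod_{i<n}k_i$; in particular (for $C=\emptyset$) $\operatorname{bdn}(a_i)<k_i$ for all $i<n$ implies $\operatorname{bdn}(a_0\dots a_{n-1})<\prod_{i<n}k_i$. -/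

import Mathlib

open FirstOrder FirstOrder.Language Cardinal

universe u v w x

namespace Burden

/-- `M` is `μ`-saturated: every set of formulas in one variable with parameters in a subset of `M`
of cardinality `< μ` which is finitely satisfiable in `M` is realized in `M`. -/
def IsSaturated (L : FirstOrder.Language.{u, v}) (M : Type w) [L.Structure M] (μ : Cardinal.{w}) : Prop :=
  ∀ A : Set M, #A < μ → ∀ Γ : Set (L[[A]].Formula Unit),
    (∀ Γ₀ : Finset (L[[A]].Formula Unit), (Γ₀ : Set (L[[A]].Formula Unit)) ⊆ Γ →
      ∃ c : Unit → M, ∀ ψ ∈ Γ₀, ψ.Realize c) →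
    ∃ c : Unit → M, ∀ ψ ∈ Γ, ψ.Realize c

/-- The complete type `tp(b/C)` of a (possibly infinite) tuple `b` over a set `C`. -/
def tp (L : FirstOrder.Language.{u, v}) {M : Type w} [L.Structure M] {ι : Type x} (b : ι → M) (C : Set M) :
    Set (L[[C]].Formula ι) :=
  {ψ | ψ.Realize b}

/-- The rows `(a α i)_{i < ω}`, formulas `φ α (x, y_α)` and numbers `k α`, for `α` in `I`, form an
inp-pattern in the partial type `p(x)` over `C`: each family `(φ α (x, a α i))_{i < ω}` is
`k α`-inconsistent (no `k α` members with pairwise distinct indices have a common solution), and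
`{φ α (x, a α (f α)) | α ∈ I} ∪ p(x)` is consistent (finitely satisfiable in `M`) for every `f`. -/
structure IsInpPattern {L : FirstOrder.Language.{u, v}} {M : Type w} [L.Structure M] {ι : Type x} {C : Set M}
    (p : Set (L[[C]].Formula ι)) {I : Type w} {m : I → ℕ}
    (φ : ∀ α, L.Formula (ι ⊕ Fin (m α))) (k : I → ℕ) (a : ∀ α, ℕ → Fin (m α) → M) : Prop where
  inconsistent : ∀ (α : I) (s : Finset ℕ), s.card = k α →
    ¬ ∃ b : ι → M, ∀ i ∈ s, (φ α).Realize (Sum.elim b (a α i))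
  consistent : ∀ (f : I → ℕ) (s : Finset I) (q : Finset (L[[C]].Formula ι)),
    (q : Set (L[[C]].Formula ι)) ⊆ p →
    ∃ b : ι → M, (∀ α ∈ s, (φ α).Realize (Sum.elim b (a α (f α)))) ∧ ∀ ψ ∈ q, ψ.Realize b

/-- There is an inp-pattern of depth `κ` in `p`. -/
def HasInpPattern {L : FirstOrder.Language.{u, v}} {M : Type w} [L.Structure M] {ι : Type x} {C : Set M}
    (p : Set (L[[C]].Formula ι)) (κ : Cardinal.{w}) : Prop :=
  ∃ I : Type w, #I = κ ∧ ∃ (m : I → ℕ) (φ : ∀ α, L.Formula (ι ⊕ Fin (m α))) (k : I → ℕ)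
    (a : ∀ α, ℕ → Fin (m α) → M), IsInpPattern p φ k a

/-- The burden of `p`: the supremum of the depths of all inp-patterns in `p`, computed among the
cardinals with a top element `∞` added, so that the supremum always exists. -/
noncomputable def bdn {L : FirstOrder.Language.{u, v}} {M : Type w} [L.Structure M] {ι : Type x} {C : Set M}
    (p : Set (L[[C]].Formula ι)) : WithTop Cardinal.{w} :=
  sSup {d | ∃ κ : Cardinal.{w}, HasInpPattern p κ ∧ d = (κ : WithTop Cardinal.{w})}

end Burden

/-!
An inp-pattern in `tp(b/C)` only depends on the sets its formulas define. By saturation, a limit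
along an iterated ultrafilter makes the rows of a pattern in `tp(b₁b₂/C)` mutually indiscernible
over `C`. Arrange `κ₁ * κ₂` such rows in `κ₂` columns of `κ₁` rows each, and select rows greedily,
at most one per column, as long as a single `x₁ ⊨ tp(b₁/C)` remains consistent with all paths
through the selected rows.

* If some column `β` remains unused, each of its rows has an obstruction: a finite set of paths
  which no single `x₁` is consistent with. Rerouting these paths through the `i`-th entry of the row
  gives, as `i` varies, a formula in `x₁` which is inconsistent by indiscernibility of the row; and
  the `κ₁` rows of formulas obtained in this way are jointly consistent, as everything outside of
  column `β` is already selected or unconstrained. This is a pattern of depth `κ₁` in `tp(b₁/C)`.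
* Otherwise a row has been selected in each column. By saturation the array can be moved over `C` so
  that `b₁` itself is consistent with all paths, which is a pattern of depth `κ₂` in `tp(b₂/b₁C)`.
-/

namespace Burden

open Filter

section Definability

variable {L : FirstOrder.Language.{u, v}} {M : Type w} [L.Structure M] {A : Set M}
  {α β : Type*}

theorem exists_finset_dependsOn {D : Set (α → M)} (hD : A.Definable L D) :
    ∃ T : Finset α, DependsOn (· ∈ D) (T : Set α) := by
  classical
  obtain ⟨φ, rfl⟩ := hD
  have restrict (z : α → M) :
      (φ.restrictFreeVar id).Realize (fun t : φ.freeVarFinset => z t) default ↔ φ.Realize z :=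
    BoundedFormula.realize_restrictFreeVar z fun _ => rfl
  refine ⟨φ.freeVarFinset, fun z z' h => propext
    ((restrict z).symm.trans (.trans ?_ (restrict z')))⟩
  rw [funext fun t : φ.freeVarFinset => h t t.2]

theorem definable_exists_sumElim [Nonempty M] {D : Set (α ⊕ β → M)} (hD : A.Definable L D) :
    A.Definable L {z | ∃ y : β → M, Sum.elim z y ∈ D} := by
  classical
  obtain ⟨T, hT⟩ := exists_finset_dependsOn hD
  let keep : β → Option T.toRight := fun b => if hb : b ∈ T.toRight then some ⟨b, hb⟩ else none
  convert (hD.preimage_comp (Sum.map id keep)).exists_of_finite using 1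
  ext z
  refine ⟨fun ⟨y, hy⟩ => ⟨fun o => o.elim (Classical.arbitrary M) fun b => y b, ?_⟩,
    fun ⟨u, hu⟩ => ⟨u ∘ keep, by simpa [Sum.elim_comp_map] using hu⟩⟩
  refine (hT fun t ht => ?_).mp hy
  rcases t with a | b
  · rfl
  · simp [keep, Finset.mem_coe.1 ht]

theorem definable_forall_mem_finset {κ : Type*} (s : Finset κ) {D : κ → Set (α → M)}
    (hD : ∀ i ∈ s, A.Definable L (D i)) : A.Definable L {z | ∀ i ∈ s, z ∈ D i} := by
  convert Set.definable_biInter_finset (fun i : s => hD i i.2) Finset.univ using 1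
  ext z
  simp

theorem definable_apply_eq (i : α) {t : M} (ht : t ∈ A) : A.Definable L {z : α → M | z i = t} :=
  (Set.Definable.singleton_of_mem L ht).preimage_comp fun _ => i

theorem definable_apply_eq_apply (i j : α) : A.Definable L {z : α → M | z i = z j} :=
  (Set.Definable.diagonal L A).preimage_comp ![i, j]

theorem definable_range_union_iff {b : α → M} {D : Set (β → M)} :
    (Set.range b ∪ A).Definable L D ↔
      ∃ E : Set (α ⊕ β → M), A.Definable L E ∧ D = {y | Sum.elim b y ∈ E} := by
  classical
  simp only [Set.definable_iff_exists_formula_sum]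
  constructor
  · rintro ⟨φ, rfl⟩
    have source (c : ↥(Set.range b ∪ A)) :
        ∃ s : A ⊕ α ⊕ β, ∀ y : β → M, Sum.elim (↑) (Sum.elim b y) s = (c : M) := by
      obtain ⟨c, ⟨i, rfl⟩ | hc⟩ := c
      exacts [⟨Sum.inr (Sum.inl i), fun _ => rfl⟩, ⟨Sum.inl ⟨c, hc⟩, fun _ => rfl⟩]
    choose s hs using source
    refine ⟨_, ⟨φ.relabel (Sum.elim s (Sum.inr ∘ Sum.inr)), rfl⟩, ?_⟩
    ext y
    simp only [Set.mem_ofPred_eq, Formula.realize_relabel]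
    refine iff_of_eq (congrArg φ.Realize (funext fun j => ?_))
    rcases j with c | j
    exacts [(hs c y).symm, rfl]
  · rintro ⟨_, ⟨φ, rfl⟩, rfl⟩
    refine ⟨φ.relabel (Sum.elim (fun a : A => Sum.inl ⟨a, Or.inr a.2⟩)
      (Sum.elim (fun i => Sum.inl ⟨b i, Or.inl ⟨i, rfl⟩⟩) Sum.inr)), ?_⟩
    ext y
    simp only [Set.mem_ofPred_eq, Formula.realize_relabel]
    refine iff_of_eq (congrArg φ.Realize (funext fun j => ?_))
    rcases j with a | i | j <;> rfl

end Definability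

section Saturation

variable {L : FirstOrder.Language.{u, v}} {M : Type w} [L.Structure M] {μ : Cardinal.{w}}
  {A : Set M} {J : Type*}

theorem IsSaturated.exists_forall_mem_unit (hM : IsSaturated L M μ) (hA : #A < μ)
    {D : J → Set (Unit → M)} (hD : ∀ j, A.Definable L (D j))
    (hfin : ∀ s : Finset J, ∃ c, ∀ j ∈ s, c ∈ D j) : ∃ c, ∀ j, c ∈ D j := by
  classical
  choose φ hφ using hD
  obtain ⟨c, hc⟩ := hM A hA (Set.range φ) fun Γ₀ hΓ₀ => by
    obtain ⟨s, -, rfl⟩ := Finset.subset_set_image_iff.1 (Set.image_univ ▸ hΓ₀)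
    obtain ⟨c, hc⟩ := hfin s
    refine ⟨c, Finset.forall_mem_image.2 fun j hj => ?_⟩
    simpa [hφ] using hc j hj
  exact ⟨c, fun j => by simpa [hφ] using hc (φ j) ⟨j, rfl⟩⟩

variable {V : Type w} {D : J → Set (V → M)} {H : Set (V × M)}

/-- The equations `z v = t` for `(v, t) ∈ H` are finitely satisfiable together with the conditions
`z ∈ D j`: the set `H` is a partial assignment which may still extend to a common point of the
sets `D j`. -/
def IsPartialSolution (D : J → Set (V → M)) (H : Set (V × M)) : Prop :=
  ∀ (s : Finset J) (K : Finset (V × M)), ↑K ⊆ H →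
    ∃ z : V → M, (∀ j ∈ s, z ∈ D j) ∧ ∀ e ∈ K, z e.1 = e.2

theorem exists_maximal_isPartialSolution (h : ∀ s : Finset J, ∃ z, ∀ j ∈ s, z ∈ D j) :
    ∃ H, Maximal (IsPartialSolution D) H := by
  have finiteCharacter : Order.IsOfFiniteCharacter {H | IsPartialSolution D H} := fun H =>
    ⟨fun hH H' hH' _ s K hK => hH s K (hK.trans hH'),
      fun hH s K hK => hH K hK K.finite_toSet s K subset_rfl⟩
  have h₀ : IsPartialSolution D ∅ := fun s K hK => (h s).imp fun z hz =>
    ⟨hz, fun e he => (hK he).elim⟩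
  obtain ⟨H, -, hH⟩ := finiteCharacter.exists_maximal h₀
  exact ⟨H, hH⟩

theorem IsPartialSolution.injOn_fst (hH : IsPartialSolution D H) : H.InjOn Prod.fst := by
  classical
  rintro ⟨i, t⟩ h ⟨_, t'⟩ h' rfl
  obtain ⟨z, -, hz⟩ := hH ∅ {(i, t), (i, t')} (by simp [Set.insert_subset_iff, h, h'])
  exact Prod.ext rfl ((hz (i, t) (by simp)).symm.trans (hz (i, t') (by simp)))

theorem IsPartialSolution.mk_snd_image_le (hH : IsPartialSolution D H) : #(Prod.snd '' H) ≤ #V :=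
  mk_image_le.trans (mk_le_of_injective (f := fun e : H => e.1.1) hH.injOn_fst.injective)

/-- The one-variable conditions imposed on `z i` by finitely many of the `D j` and of the equations
in `H` are realized by saturation. -/
theorem IsPartialSolution.exists_insert [Nonempty M] (hM : IsSaturated L M μ)
    (hH : IsPartialSolution D H) (hD : ∀ j, A.Definable L (D j))
    (hA : #↥(A ∪ Prod.snd '' H) < μ) (i : V) : ∃ t, IsPartialSolution D (insert (i, t) H) := by
  classical
  let slice (q : Finset J × {K : Finset (V × M) // ↑K ⊆ H}) : Set (Unit → M) :=
    {c | ∃ z : V → M, (∀ j ∈ q.1, z ∈ D j) ∧ (∀ e ∈ q.2.1, z e.1 = e.2) ∧ z i = c ()}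
  obtain ⟨c, hc⟩ := hM.exists_forall_mem_unit hA (D := slice)
    (fun q => by
      have hs := definable_forall_mem_finset q.1 fun j _ =>
        ((hD j).mono (Set.subset_union_left (t := Prod.snd '' H))).preimage_comp
          (Sum.inr : V → Unit ⊕ V)
      have hK := definable_forall_mem_finset q.2.1 fun e he =>
        definable_apply_eq (L := L) (A := A ∪ Prod.snd '' H) (Sum.inr e.1 : Unit ⊕ V)
          (Or.inr ⟨e, q.2.2 he, rfl⟩)
      exact definable_exists_sumElim
        (hs.inter (hK.inter (definable_apply_eq_apply (Sum.inr i) (Sum.inl ())))))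
    (fun s => by
      obtain ⟨z, hz, hzK⟩ := hH (s.biUnion Prod.fst) (s.biUnion fun q => q.2.1)
        (by simpa using fun _ q hq _ => hq)
      exact ⟨fun _ => z i, fun q hq => ⟨z, fun j hj => hz j (Finset.mem_biUnion.2 ⟨q, hq, hj⟩),
        fun e he => hzK e (Finset.mem_biUnion.2 ⟨q, hq, he⟩), rfl⟩⟩)
  refine ⟨c (), fun s K hK => ?_⟩
  obtain ⟨z, hz, hzK, hzi⟩ := hc (s, ⟨K.erase (i, c ()), by
    simpa [Set.sdiff_singleton_subset_iff] using hK⟩)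
  refine ⟨z, hz, fun e he => ?_⟩
  by_cases h : e = (i, c ())
  · rw [h, hzi]
  · exact hzK e (Finset.mem_erase.2 ⟨h, he⟩)

theorem IsSaturated.exists_forall_mem [Nonempty M] (hM : IsSaturated L M μ) (hμ : ℵ₀ ≤ μ)
    (hA : #A < μ) (hV : #V < μ) (hD : ∀ j, A.Definable L (D j))
    (hfin : ∀ s : Finset J, ∃ z, ∀ j ∈ s, z ∈ D j) : ∃ z, ∀ j, z ∈ D j := by
  classical
  obtain ⟨H, hH⟩ := exists_maximal_isPartialSolution hfin
  have hAH : #↥(A ∪ Prod.snd '' H) < μ :=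
    (mk_union_le _ _).trans_lt (add_lt_of_lt hμ hA (hH.prop.mk_snd_image_le.trans_lt hV))
  have total (i : V) : ∃ t, (i, t) ∈ H := by
    obtain ⟨t, ht⟩ := hH.prop.exists_insert hM hD hAH i
    exact ⟨t, hH.le_of_ge ht (Set.subset_insert _ _) (Set.mem_insert _ _)⟩
  choose z hz using total
  refine ⟨z, fun j => ?_⟩
  obtain ⟨T, hT⟩ := exists_finset_dependsOn (hD j)
  obtain ⟨z', hz', hz'T⟩ := hH.prop {j} (T.image fun i => (i, z i))
    (by simpa [Set.subset_def] using fun i _ => hz i)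
  exact (hT fun i hi => hz'T (i, z i) (Finset.mem_image_of_mem _ hi)).mp (hz' j (by simp))

end Saturation

section UniformlyDefinable

variable {L : FirstOrder.Language.{u, v}} {M : Type w} [L.Structure M] {A : Set M}
  {ι ι' β : Type*} {X : ℕ → Set (ι → M)}

/-- The sets `X i` are defined by instances `φ(x, e i)` of a single formula without parameters, as
the sets in a row of an inp-pattern are. -/
def UniformlyDefinable (L : FirstOrder.Language.{u, v}) {M : Type w} [L.Structure M] {ι : Type*}
    (X : ℕ → Set (ι → M)) : Prop :=
  ∃ (m : ℕ) (φ : L.Formula (ι ⊕ Fin m)) (e : ℕ → Fin m → M),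
    ∀ i, X i = {x | φ.Realize (Sum.elim x (e i))}

theorem uniformlyDefinable_of_definable [Nonempty M] {E : Set (ι ⊕ β → M)}
    (hE : A.Definable L E) (e : ℕ → β → M) :
    UniformlyDefinable L fun i => {x | Sum.elim x (e i) ∈ E} := by
  classical
  obtain ⟨φ, rfl⟩ := Set.definable_iff_exists_formula_sum.1 hE
  let number := Fintype.equivFin φ.freeVarFinset
  let rename (t : φ.freeVarFinset) : ι ⊕ Fin (Fintype.card φ.freeVarFinset) :=
    Sum.elim (fun _ => Sum.inr (number t)) (Sum.elim Sum.inl fun _ => Sum.inr (number t)) t.1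
  let value (i : ℕ) : A ⊕ ι ⊕ β → M :=
    Sum.elim (↑) (Sum.elim (fun _ => Classical.arbitrary M) (e i))
  refine ⟨_, φ.restrictFreeVar rename, fun i j => value i (number.symm j), fun i => ?_⟩
  ext x
  refine (BoundedFormula.realize_restrictFreeVar _ fun t => ?_).symm
  rcases t with ⟨a | a | a, ht⟩ <;> simp [rename, value]

theorem UniformlyDefinable.exists_definable [Nonempty M] (hX : UniformlyDefinable L X) :
    ∃ (E : Set (ι ⊕ ℕ → M)) (e : ℕ → ℕ → M), (∅ : Set M).Definable L E ∧
      ∀ i, X i = {x | Sum.elim x (e i) ∈ E} := by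
  obtain ⟨m, φ, e, hφ⟩ := hX
  let e' (i : ℕ) : ℕ → M := Function.extend Fin.val (e i) fun _ => Classical.arbitrary M
  have he' (i : ℕ) : e' i ∘ Fin.val = e i := Function.extend_comp Fin.val_injective _ _
  refine ⟨_, e',
    (Set.empty_definable_iff.2 ⟨φ, rfl⟩).preimage_comp (Sum.map id Fin.val), fun i => ?_⟩
  ext x
  simp [hφ, Sum.elim_comp_map, he']

theorem UniformlyDefinable.exists_finset_dependsOn [Nonempty M] (hX : UniformlyDefinable L X) :
    ∃ T : Finset ι, ∀ i, DependsOn (· ∈ X i) (T : Set ι) := by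
  obtain ⟨E, e, hE, hX⟩ := hX.exists_definable
  obtain ⟨T, hT⟩ := Burden.exists_finset_dependsOn hE
  refine ⟨T.toLeft, fun i x y h => ?_⟩
  simp only [hX]
  refine hT fun t ht => ?_
  rcases t with t | t
  exacts [h t (by simpa using ht), rfl]

theorem UniformlyDefinable.preimage_comp (hX : UniformlyDefinable L X) (f : ι → ι') :
    UniformlyDefinable L fun i => {x : ι' → M | x ∘ f ∈ X i} := by
  obtain ⟨m, φ, e, hφ⟩ := hX
  refine ⟨m, φ.relabel (Sum.map f id), e, fun i => ?_⟩
  ext x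
  simp [hφ, Formula.realize_relabel, Sum.elim_comp_map]

theorem UniformlyDefinable.preimage_extend [Nonempty M] (hX : UniformlyDefinable L X) (T : Set ι)
    (b : ι → M) :
    UniformlyDefinable L fun i => {y : T → M | Function.extend Subtype.val y b ∈ X i} := by
  classical
  obtain ⟨E, e, hE, hX⟩ := hX.exists_definable
  let place : ι ⊕ ℕ → T ⊕ ι ⊕ ℕ :=
    Sum.elim (fun j => if hj : j ∈ T then Sum.inl ⟨j, hj⟩ else Sum.inr (Sum.inl j))
      (Sum.inr ∘ Sum.inr)
  have hplace (y : T → M) (i : ℕ) : Sum.elim (Function.extend Subtype.val y b) (e i) =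
      Sum.elim y (Sum.elim b (e i)) ∘ place := by
    ext (j | j)
    · by_cases hj : j ∈ T
      · simp [place, hj, Subtype.val_injective.extend_apply y b ⟨j, hj⟩]
      · simp [place, hj]
    · rfl
  simpa only [hX, Set.mem_ofPred_eq, hplace] using!
    uniformlyDefinable_of_definable (hE.preimage_comp place) fun i => Sum.elim b (e i)

end UniformlyDefinable

section TypeSets

variable {L : FirstOrder.Language.{u, v}} {M : Type w} [L.Structure M] {C C' : Set M}
  {ι ι' : Type*} {b : ι → M} {D D' : Set (ι → M)}

/-- The sets defined by the formulas of `tp(b/C)`. -/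
def tpSets (L : FirstOrder.Language.{u, v}) {M : Type w} [L.Structure M] {ι : Type*} (b : ι → M)
    (C : Set M) : Set (Set (ι → M)) :=
  {D | C.Definable L D ∧ b ∈ D}

theorem univ_mem_tpSets : Set.univ ∈ tpSets L b C :=
  ⟨Set.definable_univ, trivial⟩

theorem inter_mem_tpSets (hD : D ∈ tpSets L b C) (hD' : D' ∈ tpSets L b C) :
    D ∩ D' ∈ tpSets L b C :=
  ⟨hD.1.inter hD'.1, hD.2, hD'.2⟩

theorem forall_mem_finset_mem_tpSets {κ : Type*} {D : κ → Set (ι → M)} (s : Finset κ)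
    (hD : ∀ i ∈ s, D i ∈ tpSets L b C) : {x | ∀ i ∈ s, x ∈ D i} ∈ tpSets L b C :=
  ⟨definable_forall_mem_finset s fun i hi => (hD i hi).1, fun i hi => (hD i hi).2⟩

theorem preimage_comp_mem_tpSets (f : ι' → ι) {D : Set (ι' → M)} (hD : D ∈ tpSets L (b ∘ f) C) :
    {x : ι → M | x ∘ f ∈ D} ∈ tpSets L b C :=
  ⟨hD.1.preimage_comp f, hD.2⟩

theorem tpSets_mono (hC : C ⊆ C') : tpSets L b C ⊆ tpSets L b C' :=
  fun _ hD => ⟨hD.1.mono hC, hD.2⟩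

end TypeSets

section InpFamily

variable {T I I' : Type*} {𝒟 𝒟' : Set (Set T)} {X : I → ℕ → Set T} {k : I → ℕ}

/-- The combinatorial content of an inp-pattern: the rows `X α` of sets are `k α`-inconsistent, and
every path through the rows is finitely consistent with every member of `𝒟`. For
`𝒟 = tpSets L b C` and uniformly definable rows this is an inp-pattern in `tp(b/C)`. -/
structure IsInpFamily (𝒟 : Set (Set T)) (X : I → ℕ → Set T) (k : I → ℕ) : Prop where
  inconsistent : ∀ (α : I) (s : Finset ℕ), s.card = k α → ¬ ∃ x, ∀ i ∈ s, x ∈ X α i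
  consistent : ∀ (f : I → ℕ) (s : Finset I), ∀ D ∈ 𝒟, ∃ x ∈ D, ∀ α ∈ s, x ∈ X α (f α)

theorem IsInpFamily.mono (h : IsInpFamily 𝒟 X k) (h𝒟 : 𝒟' ⊆ 𝒟) : IsInpFamily 𝒟' X k :=
  ⟨h.inconsistent, fun f s D hD => h.consistent f s D (h𝒟 hD)⟩

theorem IsInpFamily.comp (h : IsInpFamily 𝒟 X k) (g : I' ↪ I) :
    IsInpFamily 𝒟 (fun α => X (g α)) (k ∘ g) := by
  refine ⟨fun α => h.inconsistent (g α), fun f s D hD => ?_⟩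
  obtain ⟨x, hxD, hx⟩ := h.consistent (Function.extend g f 0) (s.map g) D hD
  refine ⟨x, hxD, fun α hα => ?_⟩
  simpa only [g.injective.extend_apply] using hx (g α) (Finset.mem_map_of_mem g hα)

end InpFamily

section Patterns

variable {L : FirstOrder.Language.{u, v}} {M : Type w} [L.Structure M] {C C' : Set M}
  {ι ι' : Type x} {b : ι → M} {κ κ' : Cardinal.{w}} {I : Type w}

theorem isInpPattern_tp_iff {m : I → ℕ} {φ : ∀ α, L.Formula (ι ⊕ Fin (m α))} {k : I → ℕ}
    {a : ∀ α, ℕ → Fin (m α) → M} :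
    IsInpPattern (tp L b C) φ k a ↔
      IsInpFamily (tpSets L b C) (fun α i => {x | (φ α).Realize (Sum.elim x (a α i))}) k := by
  refine ⟨fun h => ⟨h.inconsistent, ?_⟩, fun h => ⟨h.inconsistent, fun f s q hq => ?_⟩⟩
  · rintro f s _ ⟨⟨ψ, rfl⟩, hb⟩
    obtain ⟨x, hx, hq⟩ := h.consistent f s {ψ} (by simpa [tp] using hb)
    exact ⟨x, hq ψ (by simp), hx⟩
  · obtain ⟨x, hxq, hx⟩ := h.consistent f s _
      (forall_mem_finset_mem_tpSets q fun ψ hψ => ⟨⟨ψ, rfl⟩, hq hψ⟩)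
    exact ⟨x, hx, hxq⟩

theorem IsInpFamily.hasInpPattern {X : I → ℕ → Set (ι → M)} {k : I → ℕ}
    (h : IsInpFamily (tpSets L b C) X k) (hX : ∀ α, UniformlyDefinable L (X α)) :
    HasInpPattern (tp L b C) #I := by
  choose m φ a ha using hX
  refine ⟨I, rfl, m, φ, k, a, isInpPattern_tp_iff.2 ?_⟩
  rwa [← funext fun α => funext (ha α)]

theorem HasInpPattern.exists_isInpFamily (h : HasInpPattern (tp L b C) κ) (hI : #I ≤ κ) :
    ∃ (X : I → ℕ → Set (ι → M)) (k : I → ℕ), (∀ α, UniformlyDefinable L (X α)) ∧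
      IsInpFamily (tpSets L b C) X k := by
  obtain ⟨_, rfl, m, φ, k, a, h⟩ := h
  obtain ⟨g⟩ := hI
  exact ⟨_, _, fun α => ⟨m (g α), φ (g α), a (g α), fun _ => rfl⟩,
    (isInpPattern_tp_iff.1 h).comp g⟩

theorem HasInpPattern.of_le (hκ : κ' ≤ κ) (h : HasInpPattern (tp L b C) κ) :
    HasInpPattern (tp L b C) κ' := by
  rw [← mk_out κ'] at hκ ⊢
  obtain ⟨X, k, hX, h⟩ := h.exists_isInpFamily hκ
  exact h.hasInpPattern hX

theorem HasInpPattern.mono_params (hC : C ⊆ C') (h : HasInpPattern (tp L b C') κ) :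
    HasInpPattern (tp L b C) κ := by
  rw [← mk_out κ] at h ⊢
  obtain ⟨X, k, hX, h⟩ := h.exists_isInpFamily le_rfl
  exact (h.mono (tpSets_mono hC)).hasInpPattern hX

/-- A condition on all of `b` restricts the finitely many coordinates of `b ∘ f` used by a finite
part of a path through its projection, which is a condition on `b ∘ f`. -/
theorem HasInpPattern.of_comp [Nonempty M] (f : ι' → ι)
    (h : HasInpPattern (tp L (b ∘ f) C) κ) : HasInpPattern (tp L b C) κ := by
  classical
  rw [← mk_out κ] at h ⊢
  obtain ⟨X, k, hX, h⟩ := h.exists_isInpFamily le_rfl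
  refine IsInpFamily.hasInpPattern (X := fun α i => {x | x ∘ f ∈ X α i}) (k := k)
    ⟨fun α s hs ⟨x, hx⟩ => h.inconsistent α s hs ⟨x ∘ f, hx⟩, fun g s D hD => ?_⟩
    fun α => (hX α).preimage_comp f
  choose support hsupport using fun α => (hX α).exists_finset_dependsOn
  let S := s.biUnion support
  let D' : Set (ι' → M) := {y | ∃ x ∈ D, ∀ t ∈ S, x (f t) = y t}
  have hD' : D' ∈ tpSets L (b ∘ f) C := by
    have agree := definable_forall_mem_finset S fun t _ =>
      definable_apply_eq_apply (L := L) (A := C) (Sum.inr (f t)) (Sum.inl t)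
    exact ⟨definable_exists_sumElim ((hD.1.preimage_comp Sum.inr).inter agree), b, hD.2,
      fun _ _ => rfl⟩
  obtain ⟨y, ⟨x, hxD, hxy⟩, hy⟩ := h.consistent g s D' hD'
  refine ⟨x, hxD, fun α hα => (hsupport α (g α) fun t ht => ?_).mpr (hy α hα)⟩
  exact hxy t (Finset.mem_biUnion.2 ⟨α, hα, ht⟩)

theorem HasInpPattern.exists_restrict [Nonempty M] {μ : Cardinal.{w}} (hμ : ℵ₀ < μ) (hκ : κ < μ)
    (h : HasInpPattern (tp L b C) κ) :
    ∃ T : Set ι, lift.{w} #T < lift.{x} μ ∧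
      HasInpPattern (tp L (b ∘ ((↑) : T → ι)) C) κ := by
  rw [← mk_out κ] at h hκ ⊢
  obtain ⟨X, k, hX, h⟩ := h.exists_isInpFamily le_rfl
  choose support hsupport using fun α => (hX α).exists_finset_dependsOn
  let T : Set ι := ⋃ α, support α
  have hT (α i) (x : ι → M) : Function.extend Subtype.val (fun t : T => x t) b ∈ X α i ↔
      x ∈ X α i := by
    refine iff_of_eq (hsupport α i fun t ht => ?_)
    exact Subtype.val_injective.extend_apply _ b ⟨t, Set.mem_iUnion_of_mem α ht⟩
  refine ⟨T, ?_, IsInpFamily.hasInpPattern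
    (X := fun α i => {y : T → M | Function.extend Subtype.val y b ∈ X α i})
    ⟨fun α s hs ⟨y, hy⟩ => h.inconsistent α s hs ⟨_, hy⟩, fun f s D hD => ?_⟩
    fun α => (hX α).preimage_extend T b⟩
  · refine (mk_iUnion_le_lift _).trans_lt (mul_lt_of_lt (by simpa using hμ.le) (by simpa using hκ)
      (lt_of_le_of_lt (ciSup_le' fun α => ?_) (by simpa using hμ : ℵ₀ < lift.{x} μ)))
    simp
  · obtain ⟨x, hxD, hx⟩ := h.consistent f s _ (preimage_comp_mem_tpSets _ hD)
    exact ⟨_, hxD, fun α hα => (hT α _ x).2 (hx α hα)⟩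

end Patterns

section IteratedUltrafilter

variable {ι : Type*}

/-- The iterated power of a nonprincipal ultrafilter on `ℕ` which chooses new values of `v` at the
members of a list, those at later members generic over those at earlier ones. -/
noncomputable def iterHyperfilter [DecidableEq ι] : List ι → (ι → ℕ) → Ultrafilter (ι → ℕ)
  | [], v => pure v
  | x :: l, v => (hyperfilter ℕ).bind fun i => iterHyperfilter l (Function.update v x i)

section DecidableEq

variable [DecidableEq ι] {P : (ι → ℕ) → Prop} {l : List ι} {v v' : ι → ℕ}

theorem eventually_iterHyperfilter_nil : (∀ᶠ w in iterHyperfilter [] v, P w) ↔ P v :=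
  Iff.rfl

theorem eventually_iterHyperfilter_cons {x : ι} :
    (∀ᶠ w in iterHyperfilter (x :: l) v, P w) ↔
      ∀ᶠ i in hyperfilter ℕ, ∀ᶠ w in iterHyperfilter l (Function.update v x i), P w :=
  Iff.rfl

theorem eventually_iterHyperfilter_congr {S : Set ι} (hP : DependsOn P S)
    (h : ∀ x ∈ S, x ∉ l → v x = v' x) :
    (∀ᶠ w in iterHyperfilter l v, P w) ↔ ∀ᶠ w in iterHyperfilter l v', P w := by
  induction l generalizing v v' with
  | nil => exact iff_of_eq (hP fun x hx => h x hx List.not_mem_nil)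
  | cons y l ih =>
    refine eventually_congr (Eventually.of_forall fun i => ih fun x hx hxl => ?_)
    by_cases hxy : x = y
    · simp [hxy]
    · simpa [hxy] using h x hx (by simp [hxy, hxl])

theorem eventually_iterHyperfilter_filter {S : Finset ι} (hP : DependsOn P S) :
    (∀ᶠ w in iterHyperfilter (l.filter (· ∈ S)) v, P w) ↔ ∀ᶠ w in iterHyperfilter l v, P w := by
  induction l generalizing v with
  | nil => rfl
  | cons y l ih =>
    by_cases hy : y ∈ S
    · simp only [List.filter_cons_of_pos, hy, decide_true, eventually_iterHyperfilter_cons, ih]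
    · have unchanged (i : ℕ) := eventually_iterHyperfilter_congr (l := l) (v' := v) hP
        fun x hx _ => Function.update_of_ne (ne_of_mem_of_not_mem hx hy) i v
      simp only [List.filter_cons, hy, decide_false, Bool.false_eq_true, if_false,
        eventually_iterHyperfilter_cons, ih, unchanged, eventually_const]

theorem eventually_iterHyperfilter_map {σ : ι → ι} (hσ : Function.Injective σ) :
    (∀ᶠ w in iterHyperfilter (l.map σ) v, P (w ∘ σ)) ↔
      ∀ᶠ w in iterHyperfilter l (v ∘ σ), P w := by
  induction l generalizing v with
  | nil => rfl
  | cons x l ih =>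
    simp only [List.map_cons, eventually_iterHyperfilter_cons, ih,
      Function.update_comp_eq_of_injective _ hσ]

end DecidableEq

variable [LinearOrder ι]

theorem filter_mem_sort {S T : Finset ι} (hST : S ⊆ T) : T.sort.filter (· ∈ S) = S.sort := by
  refine List.Perm.eq_of_pairwise' ((T.pairwise_sort _).filter _) (S.pairwise_sort _)
    ((List.perm_ext_iff_of_nodup ((T.sort_nodup _).filter _) (S.sort_nodup _)).2 fun x => ?_)
  simpa using fun h => hST h

variable (ι) in
/-- The type of a sequence of `ι`-many successive generic natural numbers: the common extension of
the iterated ultrafilters along the finite subsets of `ι`, listed in increasing order. -/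
noncomputable def orderedHyperfilter : Ultrafilter (ι → ℕ) :=
  (Ultrafilter.of atTop : Ultrafilter (Finset ι)).bind fun S => iterHyperfilter S.sort 0

theorem eventually_orderedHyperfilter_iff {P : (ι → ℕ) → Prop} {S : Finset ι}
    (hP : DependsOn P S) :
    (∀ᶠ v in orderedHyperfilter ι, P v) ↔ ∀ᶠ v in iterHyperfilter S.sort 0, P v := by
  have stable : ∀ᶠ T : Finset ι in ((Ultrafilter.of atTop : Ultrafilter (Finset ι)) : Filter _),
      ((∀ᶠ v in iterHyperfilter T.sort 0, P v) ↔ ∀ᶠ v in iterHyperfilter S.sort 0, P v) := by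
    refine Ultrafilter.of_le _ ((eventually_ge_atTop S).mono fun T hST => ?_)
    rw [← filter_mem_sort hST, eventually_iterHyperfilter_filter hP]
  exact (eventually_congr stable).trans eventually_const

theorem eventually_orderedHyperfilter_ne {x y : ι} (hxy : x ≠ y) :
    ∀ᶠ v in (orderedHyperfilter ι : Filter (ι → ℕ)), v x ≠ v y := by
  wlog h : x < y generalizing x y
  · exact (this hxy.symm (hxy.lt_or_gt.resolve_left h)).mono fun v hv => hv.symm
  have sort_pair : ({x, y} : Finset ι).sort = [x, y] := by
    rw [Finset.sort_insert _ (by simpa using h.le) (by simpa using hxy), Finset.sort_singleton]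
  rw [eventually_orderedHyperfilter_iff (S := {x, y}) (fun v v' hv => by
    rw [hv x (by simp), hv y (by simp)]), sort_pair]
  simp only [eventually_iterHyperfilter_cons, eventually_iterHyperfilter_nil,
    Function.update_self, Function.update_of_ne hxy]
  exact Eventually.of_forall fun i =>
    mem_of_superset (compl_mem_hyperfilter_of_finite (Set.finite_singleton i)) fun _ => Ne.symm

theorem eventually_orderedHyperfilter_comp_iff {P : (ι → ℕ) → Prop} {S : Finset ι}
    (hP : DependsOn P S) {σ : ι → ι} (hσ : StrictMono σ) :
    (∀ᶠ v in orderedHyperfilter ι, P (v ∘ σ)) ↔ ∀ᶠ v in orderedHyperfilter ι, P v := by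
  have hPσ : DependsOn (fun v => P (v ∘ σ)) (S.map ⟨σ, hσ.injective⟩) := fun v v' h =>
    hP fun x hx => h (σ x) (by simpa using ⟨x, hx, rfl⟩)
  rw [eventually_orderedHyperfilter_iff hP, eventually_orderedHyperfilter_iff hPσ,
    ← (hσ.strictMonoOn _).map_finsetSort]
  exact eventually_iterHyperfilter_map hσ.injective

end IteratedUltrafilter

section Indiscernible

variable {L : FirstOrder.Language.{u, v}} {M : Type w} [L.Structure M] {μ : Cardinal.{w}}
  {A : Set M}

theorem IsSaturated.exists_mem_iff_eventually [Nonempty M] (hM : IsSaturated L M μ) (hμ : ℵ₀ ≤ μ)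
    (hA : #A < μ) {V : Type w} (hV : #V < μ) {T : Type*} (U : Ultrafilter T) (a : T → V → M) :
    ∃ z, ∀ D, A.Definable L D → (z ∈ D ↔ ∀ᶠ t in U, a t ∈ D) := by
  obtain ⟨z, hz⟩ := hM.exists_forall_mem hμ hA hV
    (D := fun D : {D // A.Definable L D ∧ ∀ᶠ t in U, a t ∈ D} => D.1) (fun D => D.2.1)
    fun s => by
      obtain ⟨t, ht⟩ := ((eventually_all_finset s).2 fun D _ => D.2.2).exists
      exact ⟨a t, ht⟩
  refine ⟨z, fun D hD => ⟨fun h => ?_, fun h => hz ⟨D, hD, h⟩⟩⟩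
  by_contra hnot
  exact hz ⟨Dᶜ, hD.compl, Ultrafilter.eventually_not.2 hnot⟩ h

variable {R : Type w}

/-- The array whose row `r` is row `r` of `a` listed by `v r`. The entry of `a` at position `i` of
row `r` is the sequence `fun j => a (r, i, j)`. -/
def reindex (v : R → ℕ → ℕ) (a : R × ℕ × ℕ → M) : R × ℕ × ℕ → M :=
  fun e => a (e.1, v e.1 e.2.1, e.2.2)

/-- The rows of the array `z` are mutually indiscernible over `A`. Instead of comparing finite
subsequences of the rows, this compares `z` with the arrays of infinite subsequences. -/
def MutuallyIndiscernible (L : FirstOrder.Language.{u, v}) {M : Type w} [L.Structure M]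
    (A : Set M) (z : R × ℕ × ℕ → M) : Prop :=
  ∀ D, A.Definable L D → ∀ v : R → ℕ → ℕ, (∀ r, StrictMono (v r)) → (reindex v z ∈ D ↔ z ∈ D)

theorem mk_array_lt (hμ : ℵ₀ < μ) (hR : #R < μ) : #(R × ℕ × ℕ) < μ := by
  simpa using mul_lt_of_lt hμ.le hR hμ

theorem IsSaturated.exists_mutuallyIndiscernible [Nonempty M] (hM : IsSaturated L M μ)
    (hμ : ℵ₀ < μ) (hA : #A < μ) (hR : #R < μ) (a : R × ℕ × ℕ → M) :
    ∃ z, MutuallyIndiscernible L A z ∧ ∀ D, A.Definable L D → z ∈ D →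
      ∀ (Q : Finset R) (s : Finset ℕ), ∃ v : R → ℕ → ℕ,
        (∀ r ∈ Q, Set.InjOn (v r) s) ∧ reindex v a ∈ D := by
  classical
  let _ : LinearOrder R := linearOrderOfSTO (WellOrderingRel (α := R))
  let rows (v : R ×ₗ ℕ → ℕ) (r : R) (i : ℕ) : ℕ := v (toLex (r, i))
  obtain ⟨z, hz⟩ := hM.exists_mem_iff_eventually hμ.le hA (mk_array_lt hμ hR)
    (orderedHyperfilter (R ×ₗ ℕ)) fun v => reindex (rows v) a
  refine ⟨z, fun D hD v hv => ?_, fun D hD hzD Q s => ?_⟩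
  · let σ (x : R ×ₗ ℕ) : R ×ₗ ℕ := toLex ((ofLex x).1, v (ofLex x).1 (ofLex x).2)
    have hσ : StrictMono σ := by
      intro x y hxy
      rw [Prod.Lex.lt_iff] at hxy ⊢
      exact hxy.imp_right fun ⟨h, h'⟩ => ⟨h, by simpa [σ, h] using hv _ h'⟩
    obtain ⟨T, hT⟩ := exists_finset_dependsOn hD
    have hdep : DependsOn (fun w => reindex (rows w) a ∈ D)
        (T.image fun e : R × ℕ × ℕ => toLex (e.1, e.2.1)) := fun w w' h =>
      hT fun e he => by
        simp only [reindex, rows, h _ (Finset.mem_coe.2 (Finset.mem_image_of_mem _ he))]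
    have hD' : A.Definable L {z | reindex v z ∈ D} :=
      hD.preimage_comp fun e : R × ℕ × ℕ => (e.1, v e.1 e.2.1, e.2.2)
    rw [hz D hD, ← eventually_orderedHyperfilter_comp_iff hdep hσ]
    exact hz _ hD'
  · have injective : ∀ᶠ w in (orderedHyperfilter (R ×ₗ ℕ) : Filter (R ×ₗ ℕ → ℕ)),
        ∀ r ∈ Q, ∀ i ∈ s, ∀ j ∈ s, i ≠ j → rows w r i ≠ rows w r j :=
      (eventually_all_finset Q).2 fun r _ => (eventually_all_finset s).2 fun i _ =>
        (eventually_all_finset s).2 fun j _ => eventually_imp_distrib_left.2 fun hij =>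
          eventually_orderedHyperfilter_ne (by simpa using hij)
    obtain ⟨w, hinj, hw⟩ := (injective.and ((hz D hD).1 hzD)).exists
    exact ⟨rows w, fun r hr i hi j hj => not_imp_not.1 (hinj r hr i hi j hj), hw⟩

end Indiscernible

section Rows

variable {L : FirstOrder.Language.{u, v}} {M : Type w} [L.Structure M] {A C : Set M}
  {R : Type w} {ι : Type*} {E : R → Set (ι ⊕ ℕ → M)}

/-- The set `φ r (x, z r i)` in row `r` of a pattern with array `z`, where `E r` is the set defined
by the formula `φ r`. -/
def rowSet (E : R → Set (ι ⊕ ℕ → M)) (z : R × ℕ × ℕ → M) (r : R) (i : ℕ) : Set (ι → M) :=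
  {x | Sum.elim x (fun j => z (r, i, j)) ∈ E r}

theorem definable_mem_rowSet {r : R} (hE : (∅ : Set M).Definable L (E r)) (i : ℕ) :
    A.Definable L {w : ι ⊕ R × ℕ × ℕ → M | w ∘ Sum.inl ∈ rowSet E (w ∘ Sum.inr) r i} := by
  convert (hE.mono (Set.empty_subset A)).preimage_comp (Sum.map id fun j => (r, i, j)) using 1
  ext w
  refine iff_of_eq (congrArg (· ∈ E r) (funext fun j => ?_))
  rcases j with j | j <;> rfl

theorem definable_exists_forall_mem_rowSet [Nonempty M] {r : R}
    (hE : (∅ : Set M).Definable L (E r)) (s : Finset ℕ) :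
    A.Definable L {z : R × ℕ × ℕ → M | ∃ x, ∀ i ∈ s, x ∈ rowSet E z r i} :=
  definable_exists_sumElim (D := {w | ∀ i ∈ s, w ∘ Sum.inr ∈ rowSet E (w ∘ Sum.inl) r i})
    (definable_forall_mem_finset s fun i _ =>
      (definable_mem_rowSet hE i).preimage_comp (Sum.elim Sum.inr Sum.inl))

theorem IsInpFamily.exists_mutuallyIndiscernible [Nonempty M] {μ : Cardinal.{w}}
    (hM : IsSaturated L M μ) (hμ : ℵ₀ < μ) (hC : #C < μ) (hR : #R < μ) {b : ι → M}
    {X : R → ℕ → Set (ι → M)} {k : R → ℕ} (h : IsInpFamily (tpSets L b C) X k)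
    (hX : ∀ r, UniformlyDefinable L (X r)) :
    ∃ (E : R → Set (ι ⊕ ℕ → M)) (z : R × ℕ × ℕ → M), (∀ r, (∅ : Set M).Definable L (E r)) ∧
      MutuallyIndiscernible L C z ∧ IsInpFamily (tpSets L b C) (rowSet E z) k := by
  choose E a hE hXE using fun r => (hX r).exists_definable
  obtain ⟨z, hz, htransfer⟩ :=
    hM.exists_mutuallyIndiscernible hμ hC hR fun e : R × ℕ × ℕ => a e.1 e.2.1 e.2.2
  have rowSet_eq (v : R → ℕ → ℕ) (r : R) (i : ℕ) :
      rowSet E (reindex v fun e => a e.1 e.2.1 e.2.2) r i = X r (v r i) :=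
    (hXE r (v r i)).symm
  refine ⟨E, z, hE, hz, fun r s hs hx => ?_, fun f s D hD => ?_⟩
  · obtain ⟨v, hv, x, hx⟩ := htransfer _ (definable_exists_forall_mem_rowSet (hE r) s) hx {r} s
    refine h.inconsistent r (s.image (v r)) ?_ ⟨x, Finset.forall_mem_image.2 fun i hi => ?_⟩
    · rw [Finset.card_image_of_injOn (hv r (Finset.mem_singleton_self r)), hs]
    · simpa only [rowSet_eq] using hx i hi
  · by_contra hno
    have hdef : C.Definable L {z | ∃ x ∈ D, ∀ r ∈ s, x ∈ rowSet E z r (f r)} :=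
      definable_exists_sumElim (D := {w | w ∘ Sum.inr ∈ D ∧
          ∀ r ∈ s, w ∘ Sum.inr ∈ rowSet E (w ∘ Sum.inl) r (f r)})
        ((hD.1.preimage_comp Sum.inr).inter (definable_forall_mem_finset s fun r _ =>
          (definable_mem_rowSet (hE r) (f r)).preimage_comp (Sum.elim Sum.inr Sum.inl)))
    obtain ⟨v, -, hv⟩ := htransfer _ hdef.compl hno ∅ ∅
    refine hv ?_
    simpa only [Set.mem_ofPred_eq, rowSet_eq] using h.consistent (fun r => v r (f r)) s D hD

end Rows

section Paths

variable {L : FirstOrder.Language.{u, v}} {M : Type w} [L.Structure M] {A C : Set M}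
  {R : Type w} {ι₁ ι₂ : Type*} {E : R → Set ((ι₁ ⊕ ι₂) ⊕ ℕ → M)} {z : R × ℕ × ℕ → M}
  {Y : R → ℕ → Set (ι₁ ⊕ ι₂ → M)} {ψ ψ' : Set (ι₁ ⊕ ι₂ → M)} {Q Q' : Finset R} {g g' : R → ℕ}
  {x₁ : ι₁ → M}

/-- The value `x₁` of the first part of the variables is consistent with `ψ` and with the path `g`
through the rows in `Q`. -/
def PathConsistentAt (Y : R → ℕ → Set (ι₁ ⊕ ι₂ → M)) (ψ : Set (ι₁ ⊕ ι₂ → M)) (Q : Finset R)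
    (g : R → ℕ) (x₁ : ι₁ → M) : Prop :=
  ∃ x₂, Sum.elim x₁ x₂ ∈ ψ ∧ ∀ r ∈ Q, Sum.elim x₁ x₂ ∈ Y r (g r)

theorem PathConsistentAt.mono (h : PathConsistentAt Y ψ Q g x₁) (hψ : ψ ⊆ ψ') (hQ : Q' ⊆ Q)
    (hg : ∀ r ∈ Q', g r = g' r) : PathConsistentAt Y ψ' Q' g' x₁ :=
  h.imp fun _ hx => ⟨hψ hx.1, fun r hr => hg r hr ▸ hx.2 r (hQ hr)⟩

theorem definable_pathConsistentAt [Nonempty M] (hE : ∀ r, (∅ : Set M).Definable L (E r))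
    (hψ : A.Definable L ψ) (Q : Finset R) (g : R → ℕ) :
    A.Definable L {w : ι₁ ⊕ R × ℕ × ℕ → M |
      PathConsistentAt (rowSet E (w ∘ Sum.inr)) ψ Q g (w ∘ Sum.inl)} := by
  let x : ι₁ ⊕ ι₂ → (ι₁ ⊕ R × ℕ × ℕ) ⊕ ι₂ := Sum.map Sum.inl id
  convert definable_exists_sumElim ((hψ.preimage_comp x).inter
    (definable_forall_mem_finset Q fun r _ => (definable_mem_rowSet (hE r) (g r)).preimage_comp
      (Sum.elim x (Sum.inl ∘ Sum.inr)))) using 1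
  ext w
  refine exists_congr fun x₂ => ?_
  have hx : Sum.elim (w ∘ Sum.inl) x₂ = Sum.elim w x₂ ∘ x := by
    rw [Sum.elim_comp_map, Function.comp_id]
  rw [hx]
  rfl

/-- Reindexing the rows does not change which finite sets of paths are consistent over a common
value of the first part of the variables. -/
def PathIndiscernible (𝒟 : Set (Set (ι₁ ⊕ ι₂ → M))) (Y : R → ℕ → Set (ι₁ ⊕ ι₂ → M)) : Prop :=
  ∀ ψ ∈ 𝒟, ∀ (G : Finset (R → ℕ)) (Q : Finset R) (v : R → ℕ → ℕ), (∀ r, StrictMono (v r)) →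
    ((∃ x₁, ∀ g ∈ G, PathConsistentAt Y ψ Q (fun r => v r (g r)) x₁) ↔
      ∃ x₁, ∀ g ∈ G, PathConsistentAt Y ψ Q g x₁)

theorem MutuallyIndiscernible.pathIndiscernible [Nonempty M] (hz : MutuallyIndiscernible L C z)
    (hE : ∀ r, (∅ : Set M).Definable L (E r)) (b : ι₁ ⊕ ι₂ → M) :
    PathIndiscernible (tpSets L b C) (rowSet E z) := fun ψ hψ G Q v hv =>
  hz {z | ∃ x₁, ∀ g ∈ G, PathConsistentAt (rowSet E z) ψ Q g x₁}
    (definable_exists_sumElim (D := {w | ∀ g ∈ G,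
        PathConsistentAt (rowSet E (w ∘ Sum.inl)) ψ Q g (w ∘ Sum.inr)})
      (definable_forall_mem_finset G fun g _ =>
        (definable_pathConsistentAt hE hψ.1 Q g).preimage_comp (Sum.elim Sum.inr Sum.inl))) v hv

end Paths

section PartialSelection

variable {M : Type w} {I₁ I₂ : Type w} {ι₁ ι₂ : Type*} {𝒟 : Set (Set (ι₁ ⊕ ι₂ → M))}
  {Y : I₁ × I₂ → ℕ → Set (ι₁ ⊕ ι₂ → M)} {k : I₁ × I₂ → ℕ} {S : Set (I₁ × I₂)}

/-- Rows are arranged in columns by their second index. The set `S` selects at most one row per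
column, and a single value of the first part of the variables is consistent with finitely many
paths through the selected rows, even together with the initial entries `Y r 0` of finitely many
rows in the columns without a selected row. -/
structure IsPartialSelection (𝒟 : Set (Set (ι₁ ⊕ ι₂ → M))) (Y : I₁ × I₂ → ℕ → Set (ι₁ ⊕ ι₂ → M))
    (S : Set (I₁ × I₂)) : Prop where
  injOn_snd : S.InjOn Prod.snd
  consistent : ∀ ψ ∈ 𝒟, ∀ (G : Finset (I₁ × I₂ → ℕ)) (Q : Finset (I₁ × I₂)),
    (∀ r ∈ Q, r ∈ S ∨ r.2 ∉ Prod.snd '' S ∧ ∀ g ∈ G, g r = 0) →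
      ∃ x₁, ∀ g ∈ G, PathConsistentAt Y ψ Q g x₁

theorem IsInpFamily.isPartialSelection_empty (h : IsInpFamily 𝒟 Y k) :
    IsPartialSelection 𝒟 Y ∅ := by
  refine ⟨Set.injOn_empty _, fun ψ hψ G Q hQ => ?_⟩
  obtain ⟨x, hxψ, hx⟩ := h.consistent 0 Q ψ hψ
  refine ⟨x ∘ Sum.inl, fun g hg => ⟨x ∘ Sum.inr, ?_⟩⟩
  rw [Sum.elim_comp_inl_inr]
  exact ⟨hxψ, fun r hr => by simpa [((hQ r hr).resolve_left id).2 g hg] using hx r hr⟩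

theorem isPartialSelection_sUnion {c : Set (Set (I₁ × I₂))} (hne : c.Nonempty)
    (hchain : IsChain (· ⊆ ·) c) (hc : ∀ S ∈ c, IsPartialSelection 𝒟 Y S) :
    IsPartialSelection 𝒟 Y (⋃₀ c) := by
  classical
  have hdir := hchain.directedOn
  refine ⟨?_, fun ψ hψ G Q hQ => ?_⟩
  · simp only [Set.injOn_iff_pairwise_ne, Set.pairwise_sUnion hdir]
    exact fun S hS => Set.injOn_iff_pairwise_ne.1 (hc S hS).injOn_snd
  obtain ⟨S, hSc, hS⟩ := hdir.exists_mem_subset_of_finset_subset_biUnion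
    (f := id) hne (s := Q.filter (· ∈ ⋃₀ c)) (by simp [Set.subset_def])
  refine (hc S hSc).consistent ψ hψ G Q fun r hr => ?_
  by_cases hrc : r ∈ ⋃₀ c
  · exact Or.inl (hS (by simpa using ⟨hr, hrc⟩))
  · exact Or.inr (((hQ r hr).resolve_left hrc).imp_left
      (mt (Set.image_mono (Set.subset_sUnion_of_mem hSc) ·)))

theorem IsInpFamily.exists_maximal_isPartialSelection (h : IsInpFamily 𝒟 Y k) :
    ∃ S, Maximal (IsPartialSelection 𝒟 Y) S := by
  refine zorn_subset {S | IsPartialSelection 𝒟 Y S} fun c hc hchain => ?_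
  rcases c.eq_empty_or_nonempty with rfl | hne
  · exact ⟨∅, h.isPartialSelection_empty, by simp⟩
  · exact ⟨⋃₀ c, isPartialSelection_sUnion hne hchain hc, fun _ => Set.subset_sUnion_of_mem⟩

/-- By indiscernibility the initial entries in the columns without a selected row may be replaced
by arbitrary ones, through a shift of each of these rows. -/
theorem IsPartialSelection.exists_pathConsistentAt (hS : IsPartialSelection 𝒟 Y S)
    (hY : PathIndiscernible 𝒟 Y) {ψ : Set (ι₁ ⊕ ι₂ → M)} (hψ : ψ ∈ 𝒟)
    (G : Finset (I₁ × I₂ → ℕ)) {Q : Finset (I₁ × I₂)}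
    (hQ : ∀ r ∈ Q, r ∈ S ∨ r.2 ∉ Prod.snd '' S) (f : I₁ × I₂ → ℕ) [DecidablePred (· ∈ S)] :
    ∃ x₁, ∀ g ∈ G, PathConsistentAt Y ψ Q (fun r => if r ∈ S then g r else f r) x₁ := by
  classical
  let onS (g : I₁ × I₂ → ℕ) (r : I₁ × I₂) : ℕ := if r ∈ S then g r else 0
  let v (r : I₁ × I₂) (j : ℕ) : ℕ := if r ∈ S then j else j + f r
  have hv (r : I₁ × I₂) : StrictMono (v r) := by
    by_cases hr : r ∈ S
    · simpa [v, hr] using! strictMono_id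
    · simpa [v, hr] using strictMono_id.add_const (f r)
  obtain ⟨x₁, hx₁⟩ := (hY ψ hψ (G.image onS) Q v hv).2 (hS.consistent ψ hψ _ Q fun r hr =>
    (hQ r hr).imp_right fun hr₂ => ⟨hr₂, Finset.forall_mem_image.2 fun g _ =>
      if_neg fun hrS => hr₂ ⟨r, hrS, rfl⟩⟩)
  refine ⟨x₁, fun g hg => (hx₁ (onS g) (Finset.mem_image_of_mem _ hg)).mono subset_rfl
    subset_rfl fun r _ => ?_⟩
  by_cases hr : r ∈ S <;> simp [v, onS, hr]

/-- A reason why the row `(α, β)` of an unused column `β` cannot be added to `S`: no value of the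
first part of the variables is consistent with the paths in `G`. -/
structure IsObstruction (𝒟 : Set (Set (ι₁ ⊕ ι₂ → M))) (Y : I₁ × I₂ → ℕ → Set (ι₁ ⊕ ι₂ → M))
    (S : Set (I₁ × I₂)) (β : I₂) (α : I₁) (ψ : Set (ι₁ ⊕ ι₂ → M)) (G : Finset (I₁ × I₂ → ℕ))
    (Q : Finset (I₁ × I₂)) : Prop where
  mem : ψ ∈ 𝒟
  rows : ∀ r ∈ Q, r = (α, β) ∨ r ∈ S ∨ r.2 ∉ insert β (Prod.snd '' S) ∧ ∀ g ∈ G, g r = 0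
  inconsistent : ¬ ∃ x₁, ∀ g ∈ G, PathConsistentAt Y ψ Q g x₁

theorem exists_isObstruction (hS : Maximal (IsPartialSelection 𝒟 Y) S) {β : I₂}
    (hβ : β ∉ Prod.snd '' S) (α : I₁) : ∃ ψ G Q, IsObstruction 𝒟 Y S β α ψ G Q := by
  by_contra! hno
  refine hβ ⟨(α, β), hS.le_of_ge (y := insert (α, β) S) ⟨?_, fun ψ hψ G Q hQ => ?_⟩
    (Set.subset_insert _ _) (Set.mem_insert _ _), rfl⟩
  · exact (Set.injOn_insert fun h => hβ ⟨_, h, rfl⟩).2 ⟨hS.prop.injOn_snd, hβ⟩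
  · by_contra hinc
    refine hno ψ G Q ⟨hψ, fun r hr => ?_, hinc⟩
    simpa only [Set.image_insert_eq, Set.mem_insert_iff, or_assoc] using hQ r hr

open Classical in
/-- The values of the first part of the variables which are consistent with all paths in `G`,
rerouted in row `r` through its entry at position `i`. -/
def reroutedSet (Y : I₁ × I₂ → ℕ → Set (ι₁ ⊕ ι₂ → M)) (ψ : Set (ι₁ ⊕ ι₂ → M))
    (G : Finset (I₁ × I₂ → ℕ)) (Q : Finset (I₁ × I₂)) (r : I₁ × I₂) (i : ℕ) : Set (ι₁ → M) :=
  {x₁ | ∀ g ∈ G, PathConsistentAt Y ψ Q (Function.update g r i) x₁}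

theorem exists_strictMono_mem_finset (s : Finset ℕ) :
    ∃ u : ℕ → ℕ, StrictMono u ∧ ∀ j < s.card, u j ∈ s := by
  classical
  let p (m : ℕ) : Prop := m ∈ s ∨ s.sup id < m
  have hp : {m | p m}.Infinite := (Set.Ioi_infinite (s.sup id)).mono fun _ => Or.inr
  refine ⟨Nat.nth p, Nat.nth_strictMono hp, fun j hj =>
    (Nat.nth_mem_of_infinite hp j).resolve_right fun hlt => hj.not_ge ?_⟩
  rw [← Nat.count_nth_of_infinite hp j, Nat.count_eq_card_filter_range]
  refine Finset.card_le_card fun m hm => ?_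
  exact Finset.mem_filter.2
    ⟨Finset.mem_range.2 ((Finset.le_sup (f := id) hm).trans_lt hlt), Or.inl hm⟩

/-- A common member of enough of the sets `reroutedSet Y ψ G Q (α, β) i` is consistent with the
paths in `G` after a reindexing of row `(α, β)`. -/
theorem IsObstruction.reroutedSet_inconsistent (hY : PathIndiscernible 𝒟 Y) {β : I₂} {α : I₁}
    {ψ : Set (ι₁ ⊕ ι₂ → M)} {G : Finset (I₁ × I₂ → ℕ)} {Q : Finset (I₁ × I₂)}
    (h : IsObstruction 𝒟 Y S β α ψ G Q) (s : Finset ℕ)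
    (hs : s.card = G.sup (fun g => g (α, β)) + 1) :
    ¬ ∃ x₁, ∀ i ∈ s, x₁ ∈ reroutedSet Y ψ G Q (α, β) i := by
  classical
  rintro ⟨x₁, hx₁⟩
  obtain ⟨u, hu, hus⟩ := exists_strictMono_mem_finset s
  let v : I₁ × I₂ → ℕ → ℕ := Function.update (fun _ => id) (α, β) u
  have hv (r : I₁ × I₂) : StrictMono (v r) := by
    by_cases hr : r = (α, β)
    · simpa [v, hr] using hu
    · simpa [v, hr] using strictMono_id
  refine h.inconsistent ((hY ψ h.mem G Q v hv).1 ⟨x₁, fun g hg => ?_⟩)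
  have hle : g (α, β) ≤ G.sup fun g => g (α, β) :=
    Finset.le_sup (f := fun g : I₁ × I₂ → ℕ => g (α, β)) hg
  refine (hx₁ _ (hus (g (α, β)) (by omega)) g hg).mono subset_rfl subset_rfl fun r _ => ?_
  by_cases hr : r = (α, β)
  · simp [v, hr]
  · simp [v, hr]

end PartialSelection

section Column

variable {L : FirstOrder.Language.{u, v}} {M : Type w} [L.Structure M] {C : Set M}
  {I₁ I₂ : Type w} {ι₁ ι₂ : Type*} {b : ι₁ ⊕ ι₂ → M}
  {Y : I₁ × I₂ → ℕ → Set (ι₁ ⊕ ι₂ → M)} {S : Set (I₁ × I₂)}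

theorem IsPartialSelection.isInpFamily_reroutedSet (hS : IsPartialSelection (tpSets L b C) Y S)
    (hY : PathIndiscernible (tpSets L b C) Y) {β : I₂} (hβ : β ∉ Prod.snd '' S)
    {ψ : I₁ → Set (ι₁ ⊕ ι₂ → M)} {G : I₁ → Finset (I₁ × I₂ → ℕ)} {Q : I₁ → Finset (I₁ × I₂)}
    (h : ∀ α, IsObstruction (tpSets L b C) Y S β α (ψ α) (G α) (Q α)) :
    IsInpFamily (tpSets L (b ∘ Sum.inl) C) (fun α => reroutedSet Y (ψ α) (G α) (Q α) (α, β))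
      fun α => (G α).sup (fun g => g (α, β)) + 1 := by
  classical
  refine ⟨fun α => (h α).reroutedSet_inconsistent hY, fun f s D hD => ?_⟩
  let ψ' := {x | x ∘ Sum.inl ∈ D} ∩ {x | ∀ α ∈ s, x ∈ ψ α}
  have hψ' : ψ' ∈ tpSets L b C := inter_mem_tpSets (preimage_comp_mem_tpSets Sum.inl hD)
    (forall_mem_finset_mem_tpSets s fun α _ => (h α).mem)
  have hQ : ∀ r ∈ s.biUnion Q, r ∈ S ∨ r.2 ∉ Prod.snd '' S := by
    intro r hr
    obtain ⟨α, -, hr⟩ := Finset.mem_biUnion.1 hr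
    rcases (h α).rows r hr with rfl | hrS | ⟨hr₂, -⟩
    exacts [Or.inr hβ, Or.inl hrS, Or.inr (mt (Set.mem_insert_of_mem β) hr₂)]
  obtain ⟨x₁, hx₁⟩ := hS.exists_pathConsistentAt hY hψ' (insert 0 (s.biUnion G)) hQ
    fun r => if r.2 = β then f r.1 else 0
  refine ⟨x₁, ?_, fun α hα g hg => ?_⟩
  · obtain ⟨x₂, ⟨hx₂, -⟩, -⟩ := hx₁ 0 (Finset.mem_insert_self _ _)
    simpa using hx₂
  · have hg' : g ∈ insert 0 (s.biUnion G) :=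
      Finset.mem_insert_of_mem (Finset.mem_biUnion.2 ⟨α, hα, hg⟩)
    refine (hx₁ g hg').mono (fun x hx => hx.2 α hα) (Finset.subset_biUnion_of_mem Q hα)
      fun r hr => ?_
    rcases (h α).rows r hr with rfl | hrS | ⟨hr₂, hr0⟩
    · have hrS : (α, β) ∉ S := fun hrS => hβ ⟨_, hrS, rfl⟩
      simp [hrS]
    · have hr : r ≠ (α, β) := fun e => hβ ⟨r, hrS, congrArg Prod.snd e⟩
      simp [hrS, hr]
    · simp only [Set.mem_insert_iff, not_or] at hr₂
      have hrS : r ∉ S := fun hrS => hr₂.2 ⟨r, hrS, rfl⟩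
      have hr : r ≠ (α, β) := fun e => hr₂.1 (congrArg Prod.snd e)
      simp [hrS, hr₂.1, hr, hr0 g hg]

end Column

section Dichotomy

variable {L : FirstOrder.Language.{u, v}} {M : Type w} [L.Structure M] [Nonempty M] {C : Set M}
  {I₁ I₂ : Type w} {ι₁ ι₂ : Type x} {b : ι₁ ⊕ ι₂ → M}
  {E : I₁ × I₂ → Set ((ι₁ ⊕ ι₂) ⊕ ℕ → M)} {z : (I₁ × I₂) × ℕ × ℕ → M} {k : I₁ × I₂ → ℕ}

theorem uniformlyDefinable_reroutedSet (hE : ∀ r, (∅ : Set M).Definable L (E r))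
    {ψ : Set (ι₁ ⊕ ι₂ → M)} (hψ : C.Definable L ψ) (G : Finset (I₁ × I₂ → ℕ))
    (Q : Finset (I₁ × I₂)) (r : I₁ × I₂) :
    UniformlyDefinable L (reroutedSet (rowSet E z) ψ G Q r) := by
  classical
  have hdef := definable_forall_mem_finset G fun g _ => definable_pathConsistentAt hE hψ Q g
  convert uniformlyDefinable_of_definable hdef
    fun i => reindex (fun r' j => if r' = r then i else j) z using 1
  funext i
  ext x₁
  exact forall₂_congr fun g _ => iff_of_eq (congrArg (PathConsistentAt (rowSet E z) ψ Q · x₁)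
    (funext (Function.update_apply g r i)))

theorem hasInpPattern_or_exists_forall_pathConsistentAt
    (hE : ∀ r, (∅ : Set M).Definable L (E r)) (hz : MutuallyIndiscernible L C z)
    (h : IsInpFamily (tpSets L b C) (rowSet E z) k) :
    HasInpPattern (tp L (b ∘ Sum.inl) C) #I₁ ∨
      ∃ c : I₂ → I₁, ∀ ψ ∈ tpSets L b C, ∀ (G : Finset (I₂ → ℕ)) (Q : Finset I₂),
        ∃ x₁, ∀ g ∈ G, PathConsistentAt (fun β => rowSet E z (c β, β)) ψ Q g x₁ := by
  classical
  have hY := hz.pathIndiscernible hE b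
  obtain ⟨S, hS⟩ := h.exists_maximal_isPartialSelection
  by_cases hcol : ∃ β, β ∉ Prod.snd '' S
  · obtain ⟨β, hβ⟩ := hcol
    choose ψ G Q hobs using exists_isObstruction hS hβ
    exact Or.inl ((hS.prop.isInpFamily_reroutedSet hY hβ hobs).hasInpPattern fun α =>
      uniformlyDefinable_reroutedSet hE (hobs α).mem.1 (G α) (Q α) (α, β))
  · have hcol : ∀ β, ∃ α, (α, β) ∈ S := by simpa using hcol
    choose c hc using hcol
    refine Or.inr ⟨c, fun ψ hψ G Q => ?_⟩
    obtain ⟨x₁, hx₁⟩ := hS.prop.consistent ψ hψ (G.image (· ∘ Prod.snd))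
      (Q.image fun β => (c β, β)) (by simp [hc])
    refine ⟨x₁, fun g hg => ?_⟩
    obtain ⟨x₂, hx₂, hx⟩ := hx₁ _ (Finset.mem_image_of_mem _ hg)
    exact ⟨x₂, hx₂, fun β hβ => hx _ (Finset.mem_image_of_mem _ hβ)⟩

end Dichotomy

section OverFirst

variable {L : FirstOrder.Language.{u, v}} {M : Type w} [L.Structure M] [Nonempty M]
  {μ : Cardinal.{w}} {C : Set M} {R : Type w}

theorem IsSaturated.exists_forall_sumElim_mem (hM : IsSaturated L M μ) (hμ : ℵ₀ ≤ μ)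
    {ι : Type*} {b : ι → M} (hbC : #↥(Set.range b ∪ C) < μ) {V : Type w} (hV : #V < μ)
    {J : Type*} {D : J → Set (ι ⊕ V → M)} (hD : ∀ j, C.Definable L (D j))
    (hfin : ∀ s : Finset J, ∀ ψ ∈ tpSets L b C, ∃ x ∈ ψ, ∃ z, ∀ j ∈ s, Sum.elim x z ∈ D j) :
    ∃ z, ∀ j, Sum.elim b z ∈ D j := by
  refine hM.exists_forall_mem hμ hbC hV (D := fun j => {z | Sum.elim b z ∈ D j})
    (fun j => definable_range_union_iff.2 ⟨D j, hD j, rfl⟩) fun s => ?_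
  by_contra hno
  have hdef : C.Definable L {x | ∃ z, ∀ j ∈ s, Sum.elim x z ∈ D j} :=
    definable_exists_sumElim (definable_forall_mem_finset s fun j _ => hD j)
  obtain ⟨x, hx, hxz⟩ := hfin s _ ⟨hdef.compl, hno⟩
  exact hx hxz

variable {ι₁ ι₂ : Type x} {b : ι₁ ⊕ ι₂ → M} {E : R → Set ((ι₁ ⊕ ι₂) ⊕ ℕ → M)}
  {z : R × ℕ × ℕ → M} {k : R → ℕ}

theorem IsSaturated.exists_pathConsistentAt (hM : IsSaturated L M μ) (hμ : ℵ₀ < μ)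
    (hbC : #↥(Set.range (b ∘ Sum.inl) ∪ C) < μ) (hR : #R < μ)
    (hE : ∀ r, (∅ : Set M).Definable L (E r))
    (hinc : ∀ (r : R) (s : Finset ℕ), s.card = k r → ¬ ∃ x, ∀ i ∈ s, x ∈ rowSet E z r i)
    (hcons : ∀ ψ ∈ tpSets L b C, ∀ (G : Finset (R → ℕ)) (Q : Finset R),
      ∃ x₁, ∀ g ∈ G, PathConsistentAt (rowSet E z) ψ Q g x₁) :
    ∃ z' : R × ℕ × ℕ → M,
      (∀ (r : R) (s : Finset ℕ), s.card = k r → ¬ ∃ x, ∀ i ∈ s, x ∈ rowSet E z' r i) ∧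
      ∀ ψ ∈ tpSets L b C, ∀ (g : R → ℕ) (Q : Finset R),
        PathConsistentAt (rowSet E z') ψ Q g (b ∘ Sum.inl) := by
  classical
  let paths (j : tpSets L b C × (R → ℕ) × Finset R) : Set (ι₁ ⊕ R × ℕ × ℕ → M) :=
    {w | PathConsistentAt (rowSet E (w ∘ Sum.inr)) j.1 j.2.2 j.2.1 (w ∘ Sum.inl)}
  let rows (j : {j : R × Finset ℕ // j.2.card = k j.1}) : Set (ι₁ ⊕ R × ℕ × ℕ → M) :=
    {w | ∃ x, ∀ i ∈ j.1.2, x ∈ rowSet E (w ∘ Sum.inr) j.1.1 i}ᶜ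
  have hdef (j) : C.Definable L (Sum.elim paths rows j) := by
    rcases j with ⟨ψ, g, Q⟩ | ⟨⟨r, s⟩, _⟩
    · exact definable_pathConsistentAt hE ψ.2.1 Q g
    · exact ((definable_exists_forall_mem_rowSet (hE r) s).preimage_comp Sum.inr).compl
  obtain ⟨z', hz'⟩ := hM.exists_forall_sumElim_mem hμ.le hbC (mk_array_lt hμ hR) hdef
      fun s ψ hψ => by
    let ψ' := {x | x ∘ Sum.inl ∈ ψ} ∩ {x | ∀ j ∈ s.toLeft, x ∈ (j.1 : Set (ι₁ ⊕ ι₂ → M))}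
    have hψ' : ψ' ∈ tpSets L b C := inter_mem_tpSets (preimage_comp_mem_tpSets Sum.inl hψ)
      (forall_mem_finset_mem_tpSets s.toLeft fun j _ => j.1.2)
    obtain ⟨x₁, hx₁⟩ := hcons ψ' hψ' (insert 0 (s.toLeft.image fun j => j.2.1))
      (s.toLeft.biUnion fun j => j.2.2)
    obtain ⟨x₂, ⟨hx₂, -⟩, -⟩ := hx₁ 0 (Finset.mem_insert_self _ _)
    refine ⟨x₁, by simpa using hx₂, z, ?_⟩
    rintro (j | j) hj
    · have hj := Finset.mem_toLeft.2 hj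
      exact (hx₁ j.2.1 (Finset.mem_insert_of_mem (Finset.mem_image_of_mem _ hj))).mono
        (fun x hx => hx.2 j hj) (Finset.subset_biUnion_of_mem (fun j => j.2.2) hj)
        fun _ _ => rfl
    · exact hinc j.1.1 j.1.2 j.2
  exact ⟨z', fun r s hs => hz' (Sum.inr ⟨(r, s), hs⟩),
    fun ψ hψ g Q => hz' (Sum.inl (⟨ψ, hψ⟩, g, Q))⟩

theorem hasInpPattern_of_pathConsistentAt (hE : ∀ r, (∅ : Set M).Definable L (E r))
    (hinc : ∀ (r : R) (s : Finset ℕ), s.card = k r → ¬ ∃ x, ∀ i ∈ s, x ∈ rowSet E z r i)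
    (hcons : ∀ ψ ∈ tpSets L b C, ∀ (g : R → ℕ) (Q : Finset R),
        PathConsistentAt (rowSet E z) ψ Q g (b ∘ Sum.inl)) :
    HasInpPattern (tp L (b ∘ Sum.inr) (Set.range (b ∘ Sum.inl) ∪ C)) #R := by
  refine IsInpFamily.hasInpPattern
    (X := fun r i => {x₂ | Sum.elim (b ∘ Sum.inl) x₂ ∈ rowSet E z r i}) (k := k)
    ⟨fun r s hs ⟨x₂, hx₂⟩ => hinc r s hs ⟨_, hx₂⟩, fun f s D hD => ?_⟩ fun r => ?_
  · obtain ⟨ψ, hψ, rfl⟩ := definable_range_union_iff.1 hD.1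
    exact hcons ψ ⟨hψ, by simpa using hD.2⟩ f s
  · convert uniformlyDefinable_of_definable ((hE r).preimage_comp
      (Sum.elim (Sum.elim (Sum.inr ∘ Sum.inl) Sum.inl) (Sum.inr ∘ Sum.inr)))
      fun i => Sum.elim (b ∘ Sum.inl) fun j => z (r, i, j) using 1
    funext i
    ext x₂
    refine iff_of_eq (congrArg (· ∈ E r) (funext fun j => ?_))
    rcases j with (j | j) | j <;> rfl

end OverFirst

section Depth

variable {L : FirstOrder.Language.{u, v}} {M : Type w} [L.Structure M] {μ : Cardinal.{w}}
  {C : Set M}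

theorem HasInpPattern.or_of_mul [Nonempty M] (hM : IsSaturated L M μ) (hμ : ℵ₀ < μ)
    (hC : #C < μ) {ι₁ ι₂ : Type x} (hι₁ : lift.{w} #ι₁ < lift.{x} μ) {b₁ : ι₁ → M} {b₂ : ι₂ → M}
    {κ₁ κ₂ : Cardinal.{w}} (hκ₁ : κ₁ < μ) (hκ₂ : κ₂ < μ)
    (h : HasInpPattern (tp L (Sum.elim b₁ b₂) C) (κ₁ * κ₂)) :
    HasInpPattern (tp L b₁ C) κ₁ ∨ HasInpPattern (tp L b₂ (Set.range b₁ ∪ C)) κ₂ := by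
  have hb₁ : #(Set.range b₁) < μ := lift_lt.1 (mk_range_le_lift.trans_lt hι₁)
  have hbC : #↥(Set.range b₁ ∪ C) < μ :=
    (mk_union_le _ _).trans_lt (add_lt_of_lt hμ.le hb₁ hC)
  rw [← mk_out κ₁] at h hκ₁ ⊢
  rw [← mk_out κ₂] at h hκ₂ ⊢
  obtain ⟨X, k, hX, hXk⟩ := h.exists_isInpFamily (I := κ₁.out × κ₂.out) (by simp)
  have hR : #(κ₁.out × κ₂.out) < μ := by simpa using mul_lt_of_lt hμ.le hκ₁ hκ₂
  obtain ⟨E, z, hE, hz, hEk⟩ := hXk.exists_mutuallyIndiscernible hM hμ hC hR hX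
  refine (hasInpPattern_or_exists_forall_pathConsistentAt hE hz hEk).imp id ?_
  rintro ⟨c, hc⟩
  obtain ⟨z', hinc, hcons⟩ := hM.exists_pathConsistentAt (R := κ₂.out)
    (E := fun β => E (c β, β)) (z := fun e => z ((c e.1, e.1), e.2)) (k := fun β => k (c β, β))
    hμ hbC hκ₂ (fun β => hE _) (fun β => hEk.inconsistent _) hc
  exact hasInpPattern_of_pathConsistentAt (fun β => hE _) hinc hcons

theorem hasInpPattern_tp_zero {ι : Type x} (b : ι → M) : HasInpPattern (tp L b C) 0 :=
  mk_pempty ▸ IsInpFamily.hasInpPattern (I := PEmpty) (X := PEmpty.elim) (k := PEmpty.elim)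
    ⟨fun α => α.elim, fun _ _ _ hD => ⟨b, hD.2, fun α => α.elim⟩⟩ fun α => α.elim

theorem bdn_tp_lt_natCast_iff {ι : Type x} (b : ι → M) (k : ℕ) :
    bdn (tp L b C) < (k : WithTop Cardinal.{w}) ↔ ¬ HasInpPattern (tp L b C) k := by
  refine ⟨fun h hk => h.not_ge (le_sSup ⟨k, hk, by simp⟩), fun h => ?_⟩
  have below (κ : Cardinal.{w}) (hκ : HasInpPattern (tp L b C) κ) : κ < k :=
    lt_of_not_ge fun hle => h (hκ.of_le hle)
  have hk : k ≠ 0 := by simpa [pos_iff_ne_zero] using below 0 (hasInpPattern_tp_zero b)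
  obtain ⟨n, rfl⟩ := Nat.exists_eq_succ_of_ne_zero hk
  refine lt_of_le_of_lt (b := (n : WithTop Cardinal.{w})) (sSup_le ?_)
    (by exact_mod_cast n.lt_succ_self)
  rintro _ ⟨κ, hκ, rfl⟩
  have hκn : κ ≤ n := Order.lt_succ_iff.1 (by simpa using below κ hκ)
  exact_mod_cast hκn

theorem not_hasInpPattern_one_of_isEmpty {ι : Type x} [IsEmpty ι] (b : ι → M) :
    ¬ HasInpPattern (tp L b C) 1 := by
  intro h
  obtain ⟨X, k, -, hX⟩ := h.exists_isInpFamily (I := PUnit) (by simp)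
  refine hX.inconsistent default (Finset.range (k default)) (by simp) ⟨b, fun i _ => ?_⟩
  obtain ⟨x, -, hx⟩ := hX.consistent (fun _ => i) {default} Set.univ univ_mem_tpSets
  rw [Subsingleton.elim b x]
  exact hx default (Finset.mem_singleton_self _)

theorem prod_lt_of_lt (hμ : ℵ₀ < μ) {n : ℕ} {κ : Fin n → Cardinal.{w}} (hκ : ∀ i, κ i < μ) :
    ∏ i, κ i < μ :=
  Finset.prod_induction _ (· < μ) (fun _ _ => mul_lt_of_lt hμ.le) (one_lt_aleph0.trans hμ)
    fun i _ => hκ i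

theorem HasInpPattern.exists_of_prod_of_small [Nonempty M] (hM : IsSaturated L M μ) (hμ : ℵ₀ < μ)
    (hC : #C < μ) {n : ℕ} {ι : Fin n → Type x} (hι : ∀ i, lift.{w} #(ι i) < lift.{x} μ)
    {a : ∀ i, ι i → M} {κ : Fin n → Cardinal.{w}} (hκ : ∀ i, κ i < μ)
    (h : HasInpPattern (tp L (fun j : Σ i, ι i => a j.1 j.2) C) (∏ i, κ i)) :
    ∃ i, HasInpPattern (tp L (a i) C) (κ i) := by
  induction n with
  | zero =>
    rw [Fin.prod_univ_zero] at h
    exact (not_hasInpPattern_one_of_isEmpty _ h).elim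
  | succ n ih =>
    let rest (j : Σ i : Fin n, ι i.succ) : M := a j.1.succ j.2
    let split (j : Σ i, ι i) : ι 0 ⊕ Σ i : Fin n, ι i.succ :=
      Fin.cases (motive := fun i => ι i → ι 0 ⊕ Σ i : Fin n, ι i.succ) Sum.inl
        (fun i j => Sum.inr ⟨i, j⟩) j.1 j.2
    have hsplit : (fun j : Σ i, ι i => a j.1 j.2) = Sum.elim (a 0) rest ∘ split := by
      funext ⟨i, j⟩
      induction i using Fin.cases <;> rfl
    rw [hsplit, Fin.prod_univ_succ] at h
    rcases h.of_comp.or_of_mul hM hμ hC (hι 0) (hκ 0)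
      (prod_lt_of_lt hμ fun i => hκ i.succ) with h | h
    · exact ⟨0, h⟩
    · obtain ⟨i, hi⟩ := ih (a := fun i => a i.succ) (fun i => hι i.succ) (fun i => hκ i.succ)
        (h.mono_params Set.subset_union_right)
      exact ⟨i.succ, hi⟩

theorem HasInpPattern.exists_of_prod [Nonempty M] (hM : IsSaturated L M μ) (hμ : ℵ₀ < μ)
    (hC : #C < μ) {n : ℕ} {ι : Fin n → Type x} {a : ∀ i, ι i → M} {κ : Fin n → Cardinal.{w}}
    (hκ : ∀ i, κ i < μ)
    (h : HasInpPattern (tp L (fun j : Σ i, ι i => a j.1 j.2) C) (∏ i, κ i)) :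
    ∃ i, HasInpPattern (tp L (a i) C) (κ i) := by
  obtain ⟨T, hT, h⟩ := h.exists_restrict hμ (prod_lt_of_lt hμ hκ)
  let fiber (i : Fin n) : Set (ι i) := Sigma.mk i ⁻¹' T
  have hfiber (i : Fin n) : lift.{w} #(fiber i) < lift.{x} μ :=
    (lift_le.2 (mk_preimage_of_injective _ T sigma_mk_injective)).trans_lt hT
  let f (j : T) : Σ i, fiber i := ⟨j.1.1, j.1.2, j.2⟩
  have hf : HasInpPattern (tp L (fun j : Σ i, fiber i => a j.1 j.2) C) (∏ i, κ i) := h.of_comp f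
  obtain ⟨i, hi⟩ := hf.exists_of_prod_of_small hM hμ hC hfiber (a := fun i j => a i j) hκ
  exact ⟨i, hi.of_comp ((↑) : fiber i → ι i)⟩

end Depth

end Burden

theorem mainTheorem1_general (L : FirstOrder.Language.{u, v}) (M : Type w) [L.Structure M]
    [Nonempty M] (μ : Cardinal.{w}) (hμ : ℵ₀ < μ) (hM : Burden.IsSaturated L M μ)
    (C : Set M) (hC : #C < μ) :
    (∀ (ι₁ ι₂ : Type x), lift.{w} #ι₁ < lift.{x} μ →
      ∀ (b₁ : ι₁ → M) (b₂ : ι₂ → M) (κ₁ κ₂ : Cardinal.{w}), κ₁ < μ → κ₂ < μ →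
        Burden.HasInpPattern (Burden.tp L (Sum.elim b₁ b₂) C) (κ₁ * κ₂) →
        Burden.HasInpPattern (Burden.tp L b₁ C) κ₁ ∨
          Burden.HasInpPattern (Burden.tp L b₂ (Set.range b₁ ∪ C)) κ₂) ∧
    (∀ (n : ℕ) (ι : Fin n → Type x) (a : ∀ i, ι i → M) (k : Fin n → ℕ),
        (∀ i, Burden.bdn (Burden.tp L (a i) C) < (k i : WithTop Cardinal.{w})) →
        Burden.bdn (Burden.tp L (fun j : Σ i, ι i => a j.1 j.2) C) <
          ((∏ i, k i : ℕ) : WithTop Cardinal.{w})) := by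
  refine ⟨fun ι₁ ι₂ hι₁ b₁ b₂ κ₁ κ₂ hκ₁ hκ₂ h => h.or_of_mul hM hμ hC hι₁ hκ₁ hκ₂,
    fun n ι a k h => ?_⟩
  simp only [Burden.bdn_tp_lt_natCast_iff] at h ⊢
  rw [Nat.cast_prod]
  intro hprod
  obtain ⟨i, hi⟩ := hprod.exists_of_prod hM hμ hC fun i => natCast_lt_aleph0.trans hμ
  exact h i hi

theorem mainTheorem1 (L : FirstOrder.Language.{u, v}) (M : Type w) [L.Structure M] [Nonempty M]
    (μ : Cardinal.{w}) (hμ : ℵ₀ < μ) (hM : Burden.IsSaturated L M μ)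
    (C : Set M) (hC : #C < μ) :
    (∀ (ι₁ ι₂ : Type x), lift.{w} #ι₁ < lift.{x} μ → lift.{w} #ι₂ < lift.{x} μ →
      ∀ (b₁ : ι₁ → M) (b₂ : ι₂ → M) (κ₁ κ₂ : Cardinal.{w}), κ₁ < μ → κ₂ < μ →
        Burden.HasInpPattern (Burden.tp L (Sum.elim b₁ b₂) C) (κ₁ * κ₂) →
        Burden.HasInpPattern (Burden.tp L b₁ C) κ₁ ∨
          Burden.HasInpPattern (Burden.tp L b₂ (Set.range b₁ ∪ C)) κ₂) ∧
    (∀ (n : ℕ) (ι : Fin n → Type x), (∀ i, lift.{w} #(ι i) < lift.{x} μ) →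
      ∀ (a : ∀ i, ι i → M) (k : Fin n → ℕ),
        (∀ i, Burden.bdn (Burden.tp L (a i) C) < (k i : WithTop Cardinal.{w})) →
        Burden.bdn (Burden.tp L (fun j : Σ i, ι i => a j.1 j.2) C) <
          ((∏ i, k i : ℕ) : WithTop Cardinal.{w})) :=
  have general := mainTheorem1_general L M μ hμ hM C hC
  ⟨fun ι₁ ι₂ hι₁ _ => general.1 ι₁ ι₂ hι₁, fun n ι _ => general.2 n ι⟩
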